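/- Let $\mathrm P=\{0,2,3,4,\dots\}=\mathbb N\setminus\{1\}$ and let $\mathrm P\rtimes\mathbb N^\times$ be the semigroup of pairs $(m,a)$ with $m\in\mathrm P$, $a\in\mathbb N^\times=\{1,2,3,\dots\}$, and product $(m,a)(n,b)=(m+an,ab)$. A representation $W$ of $\mathrm P\rtimes\mathbb N^\times$ by isometries on a nonzero Hilbert space, with $W_{(0,1)}=1$ and $W_{pq}=W_pW_q$, is called covariant if for all $(m,a),(n,b)$ $$W_{(m,a)}W_{(m,a)}^*W_{(n,b)}W_{(n,b)}^*=\begin{cases}0&\text{if }(m+a\mathrm P)\cap(n+b\mathrm P)=\emptyset,\\ W_{(\ell,\operatorname{lcm}(a,b))}W_{(\ell,\operatorname{lcm}(a,b))}^*&\text{otherwise, with }\ell=\min\big((m+a\mathrm P)\cap(n+b\mathrm P)\big).\end{cases}$$ Let $\mathcal T(\mathrm P\rtimes\mathbb N^\times)$ be the universal $C^*$-algebra for covariant isometric representations of $\mathrm P\rtimes\mathbb N^\times$, with canonical representation $W$, and put $s=W_{(2,1)}$, $t=W_{(3,1)}$, $v_a=W_{(0,a)}$. Let $\sigma$ be the strongly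 continuous action of $\mathbb R$ on $\mathcal T(\mathrm P\rtimes\mathbb N^\times)$ with $\sigma_r(W_{(m,a)})=a^{ir}W_{(m,a)}$; equivalently $\sigma_r(s)=s$, $\sigma_r(t)=t$, $\sigma_r(v_p)=p^{ir}v_p$ for $p$ prime. For $k\in\mathbb Z$ write $x^{((k))}=x^k$ if $k\ge0$ and $x^{((k))}=(x^*)^{-k}$ if $k<0$. Let $\beta\in[1,\infty)$ and let $\phi$ be a state of $\mathcal T(\mathrm P\rtimes\mathbb N^\times)$ such that for all $a,b\in\mathbb N^\times$ and all $x_1,y_1,x_2,y_2\in\mathbb N=\{0,1,2,\dots\}$, with $m=2x_1+3y_1$ and $n=2x_2+3y_2$, $$\phi\big(s^{x_1}t^{y_1}v_av_b^*t^{*y_2}s^{*x_2}\big)=\begin{cases}0&\text{if }a\ne b\text{ or }m\not\equiv n\ (\mathrm{mod}\ a),\\ a^{-\beta}\,\phi\Big(t^{((\frac{y_1-y_2+2u}{a}))}s^{((\frac{x_1-x_2-3u}{a}))}\Big)&\text{if }a=b\text{ and }m\equiv n\ (\mathrm{mod}\ a),\end{cases}$$ where in the second case the formula is required for some $u\in\mathbb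 Z$ such that $a$ divides both $y_1-y_2+2u$ and $x_1-x_2-3u$. Then $\phi$ is a $\mathrm{KMS}_\beta$ state for $\sigma$, that is, $\phi(xy)=\phi(y\,\sigma_{i\beta}(x))$ for all analytic elements $x,y$ of $\mathcal T(\mathrm P\rtimes\mathbb N^\times)$. Here $x$ is analytic if $r\mapsto\sigma_r(x)$ is the restriction to $\mathbb R$ of an entire function $z\mapsto\sigma_z(x)$ on $\mathbb C$ with values in $\mathcal T(\mathrm P\rtimes\mathbb N^\times)$. -/

import Mathlib

open scoped ENNReal ComplexOrder

noncomputable section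

/-! ### The semigroup `P ⋊ ℕˣ`, where `P = {0, 2, 3, …}` -/

/-- An element `(m, a)` of `P ⋊ ℕˣ`: here `m ∈ P = {0, 2, 3, 4, …} = ℕ \ {1}` and `a` is a positive
natural number. -/
@[ext]
structure PN where
  m : ℕ
  hm : m ≠ 1
  a : ℕ+

namespace PN

/-- `(m, a) (n, b) = (m + a n, a b)`, with unit `(0, 1)`. -/
instance : Monoid PN where
  mul p q :=
    { m := p.m + p.a * q.m
      hm := by
        intro h
        have hp := p.hm
        have hq := q.hm
        have h0 : p.m = 0 := by omega
        rw [h0, zero_add] at h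
        exact hq (Nat.eq_one_of_mul_eq_one_left h)
      a := p.a * q.a }
  one := { m := 0, hm := Nat.zero_ne_one, a := 1 }
  mul_assoc p q r := by
    apply PN.ext
    · change (p.m + p.a * q.m) + ((p.a * q.a : ℕ+) : ℕ) * r.m = p.m + p.a * (q.m + q.a * r.m)
      push_cast
      ring
    · exact mul_assoc _ _ _
  one_mul p := by
    apply PN.ext
    · change 0 + ((1 : ℕ+) : ℕ) * p.m = p.m
      simp
    · exact one_mul _
  mul_one p := by
    apply PN.ext
    · change p.m + (p.a : ℕ) * 0 = p.m
      simp
    · exact mul_one _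

@[simp] lemma mul_m (p q : PN) : (p * q).m = p.m + p.a * q.m := rfl
@[simp] lemma mul_a (p q : PN) : (p * q).a = p.a * q.a := rfl
@[simp] lemma one_m : (1 : PN).m = 0 := rfl
@[simp] lemma one_a : (1 : PN).a = 1 := rfl

/-- The set `m + a P = {m + a j : j ∈ P} ⊆ ℕ` attached to `(m, a)`. -/
def coset (p : PN) : Set ℕ := {k | ∃ j : ℕ, j ≠ 1 ∧ k = p.m + p.a * j}

/-- `r = p ⋓ q`: for `p = (m, a)` and `q = (n, b)` with `(m + a P) ∩ (n + b P) ≠ ∅`, the element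
`p ⋓ q` is `(ℓ, lcm(a, b))`, where `ℓ` is the smallest element of `(m + a P) ∩ (n + b P)`. -/
def IsCup (p q r : PN) : Prop :=
  IsLeast (p.coset ∩ q.coset) r.m ∧ r.a = PNat.lcm p.a q.a

end PN

/-! ### Covariant isometric representations -/

/-- A covariant isometric homomorphism of `P ⋊ ℕˣ` into a unital `*`-ring: a unital homomorphism
whose values are isometries, with
`W_p W_p^* W_q W_q^* = 0` if `(m + a P) ∩ (n + b P) = ∅`, and
`W_p W_p^* W_q W_q^* = W_{p ⋓ q} W_{p ⋓ q}^*` otherwise, where `p = (m, a)` and `q = (n, b)`. -/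
structure IsCovariant {B : Type*} [Semiring B] [StarRing B] (W : PN →* B) : Prop where
  isometry : ∀ p, star (W p) * W p = 1
  disjoint : ∀ p q, p.coset ∩ q.coset = ∅ → W p * star (W p) * (W q * star (W q)) = 0
  cup : ∀ p q r, PN.IsCup p q r → W p * star (W p) * (W q * star (W q)) = W r * star (W r)

/-- A covariant isometric representation of `P ⋊ ℕˣ` on a nonzero complex Hilbert space `H`. -/
structure CovRep where
  H : Type
  [normed : NormedAddCommGroup H]
  [inner : InnerProductSpace ℂ H]
  [complete : CompleteSpace H]
  [nontrivial : Nontrivial H]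
  W : PN →* (H →L[ℂ] H)
  cov : IsCovariant W

attribute [instance] CovRep.normed CovRep.inner CovRep.complete CovRep.nontrivial

lemma IsCovariant.norm_le_one {B : Type*} [NormedRing B] [NormOneClass B] [StarRing B]
    [CStarRing B] {W : PN →* B} (h : IsCovariant W) (p : PN) : ‖W p‖ ≤ 1 := by
  have h1 : ‖W p‖ * ‖W p‖ = 1 := by
    rw [← CStarRing.norm_star_mul_self, h.isometry, norm_one]
  nlinarith [norm_nonneg (W p)]

/-- The C*-algebra of all bounded families of operators `(T_X)`, with `T_X` a bounded operator on
the space of `X`, where `X` runs over all covariant isometric representations. -/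
abbrev BigAlg : Type 1 := lp (fun X : CovRep => X.H →L[ℂ] X.H) ∞

/-- The direct sum of all covariant isometric representations. -/
def bigW : PN →* BigAlg where
  toFun p := ⟨fun X => X.W p, memℓp_infty ⟨1, by
    rintro _ ⟨X, rfl⟩
    exact X.cov.norm_le_one p⟩⟩
  map_one' := by
    apply lp.ext
    funext X
    exact X.W.map_one
  map_mul' p q := by
    apply lp.ext
    funext X
    exact X.W.map_mul p q

lemma bigW_apply (p : PN) (X : CovRep) : (bigW p : BigAlg) X = X.W p := rfl

/-! ### The algebra `𝒯(P ⋊ ℕˣ)` -/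

/-- The C*-subalgebra generated by the direct sum of all covariant isometric representations. -/
def toeplitzSubalgebra : StarSubalgebra ℂ BigAlg :=
  (StarAlgebra.adjoin ℂ (Set.range bigW)).topologicalClosure

/-- The generalized Toeplitz algebra `𝒯(P ⋊ ℕˣ)`, i.e. the universal C*-algebra for covariant
isometric representations of `P ⋊ ℕˣ`. -/
def Toeplitz : Type 1 := toeplitzSubalgebra

namespace Toeplitz

instance : CStarAlgebra Toeplitz where
  __ := (inferInstance : NormedRing toeplitzSubalgebra)
  __ := (inferInstance : StarRing toeplitzSubalgebra)
  __ := (inferInstance : NormedAlgebra ℂ toeplitzSubalgebra)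
  __ := (inferInstance : StarModule ℂ toeplitzSubalgebra)
  __ := (inferInstance : CStarRing toeplitzSubalgebra)
  complete := (inferInstance : CompleteSpace
    (StarAlgebra.adjoin ℂ (Set.range bigW)).topologicalClosure).complete

/-- The inclusion of `𝒯(P ⋊ ℕˣ)` in the algebra of bounded families. -/
def incl : Toeplitz →⋆ₐ[ℂ] BigAlg := toeplitzSubalgebra.subtype

/-- The canonical covariant isometric representation `W` of `P ⋊ ℕˣ` in `𝒯(P ⋊ ℕˣ)`. -/
def W : PN →* Toeplitz where
  toFun p := (⟨bigW p, StarSubalgebra.le_topologicalClosure _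
    (StarAlgebra.subset_adjoin ℂ _ ⟨p, rfl⟩)⟩ : toeplitzSubalgebra)
  map_one' := Subtype.ext bigW.map_one
  map_mul' p q := Subtype.ext (bigW.map_mul p q)

lemma incl_injective : Function.Injective incl := Subtype.val_injective

lemma incl_W (p : PN) : incl (W p) = bigW p := rfl

lemma isometry_incl : Isometry incl := isometry_subtype_coe

end Toeplitz

/-! ### States and the KMS condition -/

/-- A state of a unital C*-algebra: a positive linear functional with `φ(1) = 1`. -/
def IsState {A : Type*} [CStarAlgebra A] (φ : A →ₗ[ℂ] ℂ) : Prop :=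
  φ 1 = 1 ∧ ∀ x : A, 0 ≤ φ (star x * x)

/-- `F` is an entire `A`-valued function that extends `r ↦ σ_r(x)`; by the identity theorem it is
unique, and `σ_z(x)` stands for `F z`. The element `x` is analytic if such an `F` exists. -/
def IsEntireExtension {A : Type*} [CStarAlgebra A] (σ : ℝ → A ≃⋆ₐ[ℂ] A) (x : A) (F : ℂ → A) :
    Prop :=
  Differentiable ℂ F ∧ ∀ r : ℝ, F r = σ r x

/-- An element is analytic for `σ` if `r ↦ σ_r(x)` extends to an entire function. -/
def IsAnalytic {A : Type*} [CStarAlgebra A] (σ : ℝ → A ≃⋆ₐ[ℂ] A) (x : A) : Prop :=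
  ∃ F : ℂ → A, IsEntireExtension σ x F

/-- `φ` is a KMS state at inverse temperature `β` for `σ`: a state with
`φ(x y) = φ(y σ_{iβ}(x))` for all analytic `x` and `y`. -/
def IsKMSState {A : Type*} [CStarAlgebra A] (σ : ℝ → A ≃⋆ₐ[ℂ] A) (β : ℝ) (φ : A →ₗ[ℂ] ℂ) : Prop :=
  IsState φ ∧ ∀ (x y : A) (F : ℂ → A), IsEntireExtension σ x F → IsAnalytic σ y →
    φ (x * y) = φ (y * F (Complex.I * β))

/-! ### The dynamics -/

lemma phase_star_mul (a : ℕ+) (r : ℝ) :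
    star (((a : ℕ) : ℂ) ^ (r * Complex.I)) * ((a : ℕ) : ℂ) ^ (r * Complex.I) = 1 := by
  have h : ‖((a : ℕ) : ℂ) ^ (r * Complex.I)‖ = 1 := by
    rw [Complex.norm_natCast_cpow_of_pos a.pos]
    simp
  have := Complex.conj_mul' (((a : ℕ) : ℂ) ^ (r * Complex.I))
  rw [h] at this
  simpa using this

/-- The representation `(m, a) ↦ a^{ir} W_{(m, a)}`. -/
def twistHom {B : Type*} [Ring B] [Algebra ℂ B] (r : ℝ) (W : PN →* B) : PN →* B where
  toFun p := (((p.a : ℕ) : ℂ) ^ (r * Complex.I)) • W p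
  map_one' := by simp
  map_mul' p q := by
    simp only [PN.mul_a, PNat.mul_coe, Nat.cast_mul, map_mul, smul_mul_smul_comm]
    rw [Complex.natCast_mul_natCast_cpow]

lemma twistHom_apply {B : Type*} [Ring B] [Algebra ℂ B] (r : ℝ) (W : PN →* B) (p : PN) :
    twistHom r W p = (((p.a : ℕ) : ℂ) ^ (r * Complex.I)) • W p := rfl

lemma twistHom_mul_star {B : Type*} [Ring B] [StarRing B] [Algebra ℂ B] [StarModule ℂ B]
    (r : ℝ) (W : PN →* B) (p : PN) :
    twistHom r W p * star (twistHom r W p) = W p * star (W p) := by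
  rw [twistHom_apply, star_smul, smul_mul_smul_comm, mul_comm (_ ^ _), phase_star_mul, one_smul]

lemma IsCovariant.twist {B : Type*} [Ring B] [StarRing B] [Algebra ℂ B] [StarModule ℂ B]
    {W : PN →* B} (h : IsCovariant W) (r : ℝ) : IsCovariant (twistHom r W) where
  isometry p := by
    rw [twistHom_apply, star_smul, smul_mul_smul_comm, phase_star_mul, one_smul, h.isometry]
  disjoint p q hpq := by
    rw [twistHom_mul_star, twistHom_mul_star, h.disjoint p q hpq]
  cup p q s hs := by
    rw [twistHom_mul_star, twistHom_mul_star, twistHom_mul_star, h.cup p q s hs]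

/-- The covariant isometric representation `(m, a) ↦ a^{ir} W_{(m, a)}` on the space of `X`. -/
def CovRep.twist (r : ℝ) (X : CovRep) : CovRep where
  H := X.H
  W := twistHom r X.W
  cov := X.cov.twist r

/-- The `*`-endomorphism `(T_X)_X ↦ (T_{X twisted by r})_X` of the algebra of bounded families. -/
def bigSigma (r : ℝ) : BigAlg →⋆ₐ[ℂ] BigAlg where
  toFun f := ⟨fun X => f (X.twist r), memℓp_infty ⟨‖f‖, by
    rintro _ ⟨X, rfl⟩
    exact lp.norm_apply_le_norm ENNReal.top_ne_zero f (X.twist r)⟩⟩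
  map_one' := rfl
  map_mul' _ _ := rfl
  map_zero' := rfl
  map_add' _ _ := rfl
  commutes' _ := rfl
  map_star' _ := rfl

lemma bigSigma_apply (r : ℝ) (f : BigAlg) (X : CovRep) : bigSigma r f X = f (X.twist r) := rfl

lemma bigSigma_bigW (r : ℝ) (p : PN) :
    bigSigma r (bigW p) = (((p.a : ℕ) : ℂ) ^ (r * Complex.I)) • bigW p := rfl

lemma continuous_bigSigma (r : ℝ) : Continuous (bigSigma r) := by
  apply AddMonoidHomClass.continuous_of_bound (bigSigma r) 1
  intro f
  rw [one_mul]
  refine lp.norm_le_of_forall_le (norm_nonneg f) fun X => ?_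
  exact lp.norm_apply_le_norm ENNReal.top_ne_zero f (X.twist r)

lemma bigSigma_mem (r : ℝ) {f : BigAlg} (hf : f ∈ toeplitzSubalgebra) :
    bigSigma r f ∈ toeplitzSubalgebra := by
  have h : toeplitzSubalgebra ≤ toeplitzSubalgebra.comap (bigSigma r) := by
    refine StarSubalgebra.topologicalClosure_minimal ?_ ?_
    · rw [StarAlgebra.adjoin_le_iff]
      rintro _ ⟨p, rfl⟩
      change bigSigma r (bigW p) ∈ toeplitzSubalgebra
      rw [bigSigma_bigW]
      exact SMulMemClass.smul_mem _ (Toeplitz.W p).2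
    · exact (StarSubalgebra.isClosed_topologicalClosure _).preimage (continuous_bigSigma r)
  exact h hf

namespace Toeplitz

/-- The restriction of `bigSigma r` to `𝒯(P ⋊ ℕˣ)`. -/
def sigmaHom (r : ℝ) : Toeplitz →⋆ₐ[ℂ] Toeplitz :=
  StarAlgHom.codRestrict ((bigSigma r).comp incl) toeplitzSubalgebra
    fun x => bigSigma_mem r x.2

lemma incl_sigmaHom (r : ℝ) (x : Toeplitz) : incl (sigmaHom r x) = bigSigma r (incl x) := rfl

lemma sigmaHom_W (r : ℝ) (p : PN) :
    sigmaHom r (W p) = (((p.a : ℕ) : ℂ) ^ (r * Complex.I)) • W p := rfl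

/-- A closed `*`-subalgebra of `𝒯(P ⋊ ℕˣ)` that contains every `W_{(m, a)}` is everything. -/
lemma mem_of_W_mem (S : StarSubalgebra ℂ Toeplitz) (hS : IsClosed (S : Set Toeplitz))
    (hW : ∀ p, W p ∈ S) (x : Toeplitz) : x ∈ S := by
  have hemb : Topology.IsClosedEmbedding incl :=
    (StarSubalgebra.isClosed_topologicalClosure _).isClosedEmbedding_subtypeVal
  have h : toeplitzSubalgebra ≤ S.map incl := by
    refine StarSubalgebra.topologicalClosure_minimal ?_ ?_
    · rw [StarAlgebra.adjoin_le_iff]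
      rintro _ ⟨p, rfl⟩
      exact ⟨W p, hW p, rfl⟩
    · rw [StarSubalgebra.coe_map]
      exact hemb.isClosedMap _ hS
  obtain ⟨y, hy, hyx⟩ := h x.2
  have : y = x := incl_injective hyx
  exact this ▸ hy

lemma hom_ext {B : Type*} [CStarAlgebra B] {f g : Toeplitz →⋆ₐ[ℂ] B}
    (h : ∀ p, f (W p) = g (W p)) : f = g := by
  ext x
  refine mem_of_W_mem (StarAlgHom.equalizer f g) ?_ h x
  have hc : ∀ k : Toeplitz →⋆ₐ[ℂ] B, Continuous k := fun k =>
    AddMonoidHomClass.continuous_of_bound k 1 fun x => by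
      rw [one_mul]
      exact NonUnitalStarAlgHom.norm_apply_le k x
  exact isClosed_eq (hc f) (hc g)

lemma isCovariant_W : IsCovariant W where
  isometry p := by
    apply incl_injective
    apply lp.ext
    funext X
    exact X.cov.isometry p
  disjoint p q hpq := by
    apply incl_injective
    apply lp.ext
    funext X
    exact X.cov.disjoint p q hpq
  cup p q r hr := by
    apply incl_injective
    apply lp.ext
    funext X
    exact X.cov.cup p q r hr

/-- The universal property: every covariant isometric representation `X` factors through `W`. -/
lemma existsUnique_hom (X : CovRep) :
    ∃! π : Toeplitz →⋆ₐ[ℂ] (X.H →L[ℂ] X.H), ∀ p, π (W p) = X.W p := by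
  let π : Toeplitz →⋆ₐ[ℂ] (X.H →L[ℂ] X.H) :=
    { toFun := fun x => incl x X
      map_one' := rfl
      map_mul' := fun _ _ => rfl
      map_zero' := rfl
      map_add' := fun _ _ => rfl
      commutes' := fun _ => rfl
      map_star' := fun _ => rfl }
  exact ⟨π, fun _ => rfl, fun ρ hρ => hom_ext fun p => hρ p⟩

lemma sigmaHom_zero : sigmaHom 0 = StarAlgHom.id ℂ Toeplitz :=
  hom_ext fun p => by
    rw [sigmaHom_W]
    simp

lemma sigmaHom_comp (r r' : ℝ) : (sigmaHom r).comp (sigmaHom r') = sigmaHom (r + r') :=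
  hom_ext fun p => by
    rw [StarAlgHom.comp_apply, sigmaHom_W, map_smul, sigmaHom_W, sigmaHom_W, smul_smul,
      ← Complex.cpow_add _ _ (Nat.cast_ne_zero.2 p.a.ne_zero)]
    congr 2
    push_cast
    ring

/-- The dynamics `σ : ℝ → Aut 𝒯(P ⋊ ℕˣ)`, determined by `σ_r(W_{(m, a)}) = a^{ir} W_{(m, a)}`. -/
def sigma (r : ℝ) : Toeplitz ≃⋆ₐ[ℂ] Toeplitz :=
  StarAlgEquiv.ofStarAlgHom (sigmaHom r) (sigmaHom (-r))
    (by rw [sigmaHom_comp, neg_add_cancel, sigmaHom_zero])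
    (by rw [sigmaHom_comp, add_neg_cancel, sigmaHom_zero])

lemma sigma_W (r : ℝ) (p : PN) :
    sigma r (W p) = (((p.a : ℕ) : ℂ) ^ (r * Complex.I)) • W p := rfl

lemma sigma_add (r r' : ℝ) (x : Toeplitz) : sigma (r + r') x = sigma r (sigma r' x) :=
  (DFunLike.congr_fun (sigmaHom_comp r r') x).symm

/-- The action `σ` is strongly continuous. -/
lemma continuous_sigma (x : Toeplitz) : Continuous fun r => sigma r x := by
  let S : StarSubalgebra ℂ Toeplitz :=
    { carrier := {x | Continuous fun r => sigma r x}
      mul_mem' := fun {x y} hx hy => by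
        have h : (fun r => sigma r (x * y)) = (fun r => sigma r x) * fun r => sigma r y :=
          funext fun r => map_mul (sigma r) x y
        exact (congrArg Continuous h).mpr (Continuous.mul hx hy)
      add_mem' := fun {x y} hx hy => by
        have h : (fun r => sigma r (x + y)) = (fun r => sigma r x) + fun r => sigma r y :=
          funext fun r => map_add (sigma r) x y
        exact (congrArg Continuous h).mpr (Continuous.add hx hy)
      algebraMap_mem' := fun c => by
        have h : (fun r => sigma r (algebraMap ℂ Toeplitz c)) =
            fun _ => algebraMap ℂ Toeplitz c := funext fun r => (sigmaHom r).commutes' c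
        exact (congrArg Continuous h).mpr (continuous_const)
      star_mem' := fun {x} hx => by
        have h : (fun r => sigma r (star x)) = fun r => star (sigma r x) :=
          funext fun r => map_star (sigma r) x
        exact (congrArg Continuous h).mpr (Continuous.star hx) }
  refine mem_of_W_mem S ?_ ?_ x
  · refine isClosed_of_closure_subset fun y hy => ?_
    refine continuous_of_uniform_approx_of_continuous fun u hu => ?_
    obtain ⟨ε, hε, hεu⟩ := Metric.mem_uniformity_dist.1 hu
    obtain ⟨z, hz, hyz⟩ := Metric.mem_closure_iff.1 hy ε hε
    refine ⟨fun r => sigma r z, hz, fun r => hεu ?_⟩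
    rw [dist_eq_norm, ← map_sub]
    refine lt_of_le_of_lt ?_ (dist_eq_norm y z ▸ hyz)
    exact NonUnitalStarAlgHom.norm_apply_le (sigmaHom r) (y - z)
  · intro p
    change Continuous fun r : ℝ => (((p.a : ℕ) : ℂ) ^ (r * Complex.I)) • W p
    have h : Continuous fun r : ℝ => ((p.a : ℕ) : ℂ) ^ (r * Complex.I) := Continuous.const_cpow (by fun_prop) (Or.inl (Nat.cast_ne_zero.2 p.a.ne_zero))
    exact h.smul (continuous_const (y := W p))

/-! ### The generators `s`, `t` and `v_a`, and signed powers -/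

/-- `s = W_{(2, 1)}`. -/
def s : Toeplitz := W ⟨2, by decide, 1⟩

/-- `t = W_{(3, 1)}`. -/
def t : Toeplitz := W ⟨3, by decide, 1⟩

/-- `v_a = W_{(0, a)}`; since `W` is multiplicative, `v_a` is the product of the `v_p^{e_p(a)}` over
the primes `p`, where `e_p(a)` is the exponent of `p` in `a`. -/
def v (a : ℕ+) : Toeplitz := W ⟨0, Nat.zero_ne_one, a⟩

end Toeplitz

/-- The signed power `x^{((k))}`: it is `x^k` if `k ≥ 0`, and `(x^*)^{-k}` if `k < 0`. -/
def signedPow {A : Type*} [Monoid A] [Star A] (x : A) (k : ℤ) : A :=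
  if 0 ≤ k then x ^ k.toNat else star x ^ (-k).toNat

end

/-! The gap at `1` in `P` makes `s` and `t` unitary: covariance identifies range projections whose
cosets meet without the intersection being a coset of `P`. Since `s ^ 3 = t ^ 2`, the unitary `u = t
s⁻¹` satisfies `s = u ^ 2` and `t = u ^ 3`, so `W (m, a)` behaves like `u ^ m * v a`, and the
prescribed value of `φ` is `a ^ (-β) * φ (u ^ ((m - n) / a))` (`HasSpanningValues`). The auxiliary
integer in the hypothesis disappears.

From these values alone `φ (x * W r) = r.a ^ β * φ (W r * x)` follows for `x` of the form `W p *
star (W q)` (`apply_mul_W`), and then for all `x`, because such elements span a dense subspace and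
states are continuous. Products and adjoints inherit this twisted trace identity, so every `y = W p
* star (W q)` satisfies it and is an eigenvector of `σ`. For such `y` and any analytic `x`,
invariance of `φ` computes `φ (y * σ_r x)` for real `r`; the identity theorem carries the formula to
`iβ`, where it is the KMS condition. Density in `y` finishes the proof. -/

noncomputable section

/-! ### Range projections and products `W_p^* W_q` -/

namespace IsCovariant

variable {B : Type*} [Ring B] [StarRing B] {W : PN →* B}

lemma star_mul_star_mul_self (h : IsCovariant W) (p : PN) (x : B) :
    star (W p) * (W p * x) = x := by
  rw [← mul_assoc, h.isometry, one_mul]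

/-- If `r = p q`, the range projection of `W r` lies below the range projection of `W p`. -/
lemma star_mul_range (h : IsCovariant W) (p q : PN) :
    star (W (p * q)) * (W p * star (W p)) = star (W (p * q)) := by
  rw [map_mul, star_mul, mul_assoc, ← mul_assoc (star (W p)), h.isometry, one_mul]

/-- Write `E_k` for the range projection of `W (k, 1)`. Covariance gives `E₂E₃ = E₅` and `E₆E₅ =
E₈`. As `6 = 2 + 4 = 3 + 3`, the projection `E₆` lies below `E₂` and `E₃`, so `E₈ = E₆E₂E₃ = E₆`.
Compressing by `W (6, 1)` turns `E₈ = E₆` into `E₂ = 1`. -/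
lemma map_two_mul_star (h : IsCovariant W) :
    W ⟨2, by decide, 1⟩ * star (W ⟨2, by decide, 1⟩) = 1 := by
  have h5 := h.cup ⟨2, by decide, 1⟩ ⟨3, by decide, 1⟩ ⟨5, by decide, 1⟩ (by
    refine ⟨⟨⟨⟨3, by decide, rfl⟩, ⟨2, by decide, rfl⟩⟩, ?_⟩, rfl⟩
    rintro k ⟨⟨i, hi, rfl⟩, ⟨j, hj, hk⟩⟩
    simp only [PNat.one_coe, one_mul] at hk ⊢
    omega)
  have h8 := h.cup ⟨6, by decide, 1⟩ ⟨5, by decide, 1⟩ ⟨8, by decide, 1⟩ (by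
    refine ⟨⟨⟨⟨2, by decide, rfl⟩, ⟨3, by decide, rfl⟩⟩, ?_⟩, rfl⟩
    rintro k ⟨⟨i, hi, rfl⟩, ⟨j, hj, hk⟩⟩
    simp only [PNat.one_coe, one_mul] at hk ⊢
    omega)
  have e2 := h.star_mul_range ⟨2, by decide, 1⟩ ⟨4, by decide, 1⟩
  have e3 := h.star_mul_range ⟨3, by decide, 1⟩ ⟨3, by decide, 1⟩
  rw [show (⟨2, by decide, 1⟩ * ⟨4, by decide, 1⟩ : PN) = ⟨6, by decide, 1⟩ from
    PN.ext rfl rfl] at e2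
  rw [show (⟨3, by decide, 1⟩ * ⟨3, by decide, 1⟩ : PN) = ⟨6, by decide, 1⟩ from
    PN.ext rfl rfl] at e3
  rw [← h5, mul_assoc, ← mul_assoc (star (W ⟨6, _, 1⟩)), e2, e3,
    show (⟨8, by decide, 1⟩ : PN) = ⟨6, by decide, 1⟩ * ⟨2, by decide, 1⟩ from PN.ext rfl rfl,
    map_mul, star_mul] at h8
  have := congrArg (fun x => star (W ⟨6, by decide, 1⟩) * x * W ⟨6, by decide, 1⟩) h8
  simp only [mul_assoc, h.isometry, mul_one] at this
  rw [← mul_assoc, h.isometry, one_mul] at this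
  exact this.symm

/-- In `E₃E₄ = E₆` the projections `E₄` and `E₆` are `1`, because `W (2, 1)` is unitary. -/
lemma map_three_mul_star (h : IsCovariant W) :
    W ⟨3, by decide, 1⟩ * star (W ⟨3, by decide, 1⟩) = 1 := by
  have h2 := h.map_two_mul_star
  have h6 := h.cup ⟨3, by decide, 1⟩ ⟨4, by decide, 1⟩ ⟨6, by decide, 1⟩ (by
    refine ⟨⟨⟨⟨3, by decide, rfl⟩, ⟨2, by decide, rfl⟩⟩, ?_⟩, rfl⟩
    rintro k ⟨⟨i, hi, rfl⟩, ⟨j, hj, hk⟩⟩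
    simp only [PNat.one_coe, one_mul] at hk ⊢
    omega)
  rw [show (⟨6, by decide, 1⟩ : PN) = ⟨2, by decide, 1⟩ * ⟨4, by decide, 1⟩ from PN.ext rfl rfl,
    show (⟨4, by decide, 1⟩ : PN) = ⟨2, by decide, 1⟩ * ⟨2, by decide, 1⟩ from PN.ext rfl rfl] at h6
  simpa only [map_mul, star_mul, mul_assoc, ← mul_assoc (W ⟨2, _, 1⟩) (star (W ⟨2, _, 1⟩)), h2,
    one_mul, mul_one] using h6

/-- `W_p^* W_q = W_{p'} W_{q'}^*` whenever the cosets of `p` and `q` meet. -/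
lemma exists_star_mul_eq (h : IsCovariant W) {p q : PN} (hpq : (p.coset ∩ q.coset).Nonempty) :
    ∃ p' q' : PN, p * p' = q * q' ∧ (p * p').a = PNat.lcm p.a q.a ∧
      star (W p) * W q = W p' * star (W q') := by
  obtain ⟨⟨j, hj, hjp⟩, ⟨i, hi, hiq⟩⟩ := Nat.sInf_mem hpq
  obtain ⟨c, hc⟩ := PNat.dvd_lcm_left p.a q.a
  obtain ⟨d, hd⟩ := PNat.dvd_lcm_right p.a q.a
  have hl : p * ⟨j, hj, c⟩ = q * ⟨i, hi, d⟩ :=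
    PN.ext (hjp.symm.trans hiq) (hc.symm.trans hd)
  refine ⟨⟨j, hj, c⟩, ⟨i, hi, d⟩, hl, hc.symm, ?_⟩
  have hcup := h.cup p q (p * ⟨j, hj, c⟩)
    ⟨by rw [show (p * ⟨j, hj, c⟩).m = sInf (p.coset ∩ q.coset) from hjp.symm]
        exact ⟨Nat.sInf_mem hpq, fun k hk => Nat.sInf_le hk⟩, hc.symm⟩
  -- On the right, `W_r` is factored as `W_p W_{p'}` but its adjoint through `W_q W_{q'}`, so that
  -- both outer isometries cancel.
  have := congrArg (fun x => star (W p) * x * W q) hcup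
  conv_rhs at this => rw [show star (W (p * ⟨j, hj, c⟩)) = star (W (q * ⟨i, hi, d⟩)) by rw [hl]]
  simpa only [map_mul, star_mul, mul_assoc, h.isometry, mul_one, h.star_mul_star_mul_self p]
    using this

lemma star_mul_eq_zero (h : IsCovariant W) {p q : PN} (hpq : p.coset ∩ q.coset = ∅) :
    star (W p) * W q = 0 := by
  have := congrArg (fun x => star (W p) * x * W q) (h.disjoint p q hpq)
  simpa only [mul_assoc, h.isometry, mul_one, h.star_mul_star_mul_self p, mul_zero, zero_mul]
    using this

end IsCovariant

/-! ### States, and signed powers of unitaries -/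

lemma LinearMap.continuous_of_isState {A : Type*} [CStarAlgebra A] {φ : A →ₗ[ℂ] ℂ}
    (hφ : IsState φ) : Continuous φ := by
  let _ : PartialOrder A := CStarAlgebra.spectralOrder A
  have : StarOrderedRing A := CStarAlgebra.spectralOrderedRing A
  have hpos : ∀ x, 0 ≤ x → 0 ≤ φ x := by
    intro x hx
    obtain ⟨y, rfl⟩ := CStarAlgebra.nonneg_iff_eq_star_mul_self.mp hx
    exact hφ.2 y
  exact map_continuous (PositiveLinearMap.mk₀ φ hpos)

/-- A state is self-adjoint. -/
lemma IsState.map_star {A : Type*} [CStarAlgebra A] {φ : A →ₗ[ℂ] ℂ}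
    (hφ : IsState φ) (x : A) : φ (star x) = star (φ x) := by
  let _ : PartialOrder A := CStarAlgebra.spectralOrder A
  have : StarOrderedRing A := CStarAlgebra.spectralOrderedRing A
  have hpos : ∀ x, 0 ≤ x → 0 ≤ φ x := by
    intro x hx
    obtain ⟨y, rfl⟩ := CStarAlgebra.nonneg_iff_eq_star_mul_self.mp hx
    exact hφ.2 y
  exact StarHomClass.map_star (PositiveLinearMap.mk₀ φ hpos) x

lemma signedPow_coe {A : Type*} [Monoid A] [StarMul A] (x : unitary A) (k : ℤ) :
    signedPow (x : A) k = ((x ^ k : unitary A) : A) := by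
  unfold signedPow
  split_ifs with hk
  · obtain ⟨n, rfl⟩ := Int.eq_ofNat_of_zero_le hk
    simp
  · obtain ⟨n, hn⟩ := Int.eq_ofNat_of_zero_le (by omega : 0 ≤ -k)
    obtain rfl : k = -n := by omega
    simp [← Unitary.star_eq_inv]

/-! ### The unitary `u` and the normal form of `W_p W_q^*` -/

namespace Toeplitz

lemma s_mem_unitary : s ∈ unitary Toeplitz :=
  ⟨isCovariant_W.isometry _, isCovariant_W.map_two_mul_star⟩

lemma t_mem_unitary : t ∈ unitary Toeplitz :=
  ⟨isCovariant_W.isometry _, isCovariant_W.map_three_mul_star⟩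

/-- The unitary `t s⁻¹`, which plays the role of the missing element `W_{(1, 1)}`. -/
def u : unitary Toeplitz := ⟨t, t_mem_unitary⟩ * ⟨s, s_mem_unitary⟩⁻¹

lemma commute_s_t : s * t = t * s := by
  simp only [s, t, ← map_mul]
  exact congrArg W (PN.ext rfl rfl)

lemma s_pow_three : s ^ 3 = t ^ 2 := by
  simp only [s, t, ← map_pow]
  exact congrArg W (PN.ext rfl rfl)

lemma commute_unitary_s_t :
    Commute (⟨s, s_mem_unitary⟩ : unitary Toeplitz) ⟨t, t_mem_unitary⟩ :=
  Subtype.ext commute_s_t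

lemma s_eq : (⟨s, s_mem_unitary⟩ : unitary Toeplitz) = u ^ 2 := by
  have h : (⟨s, s_mem_unitary⟩ : unitary Toeplitz) ^ 3 = ⟨t, t_mem_unitary⟩ ^ 2 :=
    Subtype.ext s_pow_three
  rw [u, (commute_unitary_s_t.symm.inv_right).mul_pow, ← h]
  group

lemma t_eq : (⟨t, t_mem_unitary⟩ : unitary Toeplitz) = u ^ 3 := by
  have h : (⟨s, s_mem_unitary⟩ : unitary Toeplitz) ^ 3 = ⟨t, t_mem_unitary⟩ ^ 2 :=
    Subtype.ext s_pow_three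
  rw [u, (commute_unitary_s_t.symm.inv_right).mul_pow, inv_pow, h]
  group

lemma signedPow_mul_signedPow (l k : ℤ) :
    signedPow t l * signedPow s k = ((u ^ (3 * l + 2 * k) : unitary Toeplitz) : Toeplitz) := by
  have ht := signedPow_coe (⟨t, t_mem_unitary⟩ : unitary Toeplitz) l
  have hs := signedPow_coe (⟨s, s_mem_unitary⟩ : unitary Toeplitz) k
  rw [show signedPow t l = _ from ht, show signedPow s k = _ from hs, s_eq, t_eq, ← Submonoid.coe_mul,
    zpow_add, zpow_mul, zpow_mul]
  rfl

lemma W_eq (x y : ℕ) (a : ℕ+) (h : 2 * x + 3 * y ≠ 1) :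
    W ⟨2 * x + 3 * y, h, a⟩ = s ^ x * t ^ y * v a := by
  have hx (n m : ℕ) (hm : m ≠ 1) : ∀ h, W ⟨n * m, h, 1⟩ = W ⟨m, hm, 1⟩ ^ n := by
    induction n with
    | zero =>
      intro h
      rw [pow_zero, ← map_one W]
      exact congrArg W (PN.ext (zero_mul m) rfl)
    | succ n ih =>
      intro h
      have h' : n * m ≠ 1 := fun e => hm (Nat.eq_one_of_mul_eq_one_left e)
      rw [pow_succ, ← ih h', ← map_mul]
      refine congrArg W (PN.ext ?_ rfl)
      simp [add_mul]
  rw [s, t, v, ← hx x 2 _ (by omega), ← hx y 3 _ (by omega), ← map_mul, ← map_mul]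
  refine congrArg W (PN.ext ?_ ?_)
  · simp; ring
  · simp

lemma exists_W_eq (p : PN) :
    ∃ x y : ℕ, p.m = 2 * x + 3 * y ∧ W p = s ^ x * t ^ y * v p.a := by
  obtain ⟨x, y, h⟩ : ∃ x y : ℕ, p.m = 2 * x + 3 * y := by
    have := p.hm
    rcases Nat.even_or_odd' p.m with ⟨k, hk | hk⟩
    · exact ⟨k, 0, by omega⟩
    -- Here `p.m = 2 * k + 1 ≠ 1` forces `k ≥ 1`, so the subtraction is not truncated.
    · exact ⟨k - 1, 1, by omega⟩
  refine ⟨x, y, h, ?_⟩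
  rw [← W_eq x y p.a (h ▸ p.hm)]
  exact congrArg W (PN.ext h rfl)

lemma exists_W_mul_star_eq (p q : PN) :
    ∃ x₁ y₁ x₂ y₂ : ℕ, p.m = 2 * x₁ + 3 * y₁ ∧ q.m = 2 * x₂ + 3 * y₂ ∧
      W p * star (W q) =
        s ^ x₁ * t ^ y₁ * v p.a * star (v q.a) * star t ^ y₂ * star s ^ x₂ := by
  obtain ⟨x₁, y₁, hp, hWp⟩ := exists_W_eq p
  obtain ⟨x₂, y₂, hq, hWq⟩ := exists_W_eq q
  exact ⟨x₁, y₁, x₂, y₂, hp, hq, by simp only [hWp, hWq, star_mul, star_pow, mul_assoc]⟩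

end Toeplitz

namespace PN

/-- The cosets of `p` and `q` meet if their offsets agree modulo `q.a`, up to a multiple of
`p.a`. -/
lemma coset_inter_nonempty {p q : PN} {x y : ℤ}
    (h : (p.m : ℤ) + p.a * x = q.m + q.a * y) : (p.coset ∩ q.coset).Nonempty := by
  have hp : (1 : ℤ) ≤ p.a := by exact_mod_cast p.a.pos
  have hq : (1 : ℤ) ≤ q.a := by exact_mod_cast q.a.pos
  -- Shifting `x` by `q.a * N` and `y` by `p.a * N` preserves the equation; this `N` makes both
  -- coordinates at least `2`, clear of the gap at `1`.
  have hX : 2 ≤ x + q.a * (|x| + |y| + 2) := by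
    nlinarith [neg_abs_le x, abs_nonneg x, abs_nonneg y]
  have hY : 2 ≤ y + p.a * (|x| + |y| + 2) := by
    nlinarith [neg_abs_le y, abs_nonneg x, abs_nonneg y]
  obtain ⟨X, hX'⟩ := Int.eq_ofNat_of_zero_le (by omega : 0 ≤ x + q.a * (|x| + |y| + 2))
  obtain ⟨Y, hY'⟩ := Int.eq_ofNat_of_zero_le (by omega : 0 ≤ y + p.a * (|x| + |y| + 2))
  refine ⟨p.m + p.a * X, ⟨X, by omega, rfl⟩, ⟨Y, by omega, ?_⟩⟩
  zify
  rw [← hX', ← hY']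
  linear_combination h

end PN

/-- The closure of a unital subspace closed under products and adjoints is a `*`-subalgebra. -/
lemma Submodule.exists_starSubalgebra_coe_eq_closure {A : Type*} [CStarAlgebra A]
    (V : Submodule ℂ A) (h1 : 1 ∈ V) (hmul : ∀ x ∈ V, ∀ y ∈ V, x * y ∈ V)
    (hstar : ∀ x ∈ V, star x ∈ V) :
    ∃ S : StarSubalgebra ℂ A, (S : Set A) = closure (V : Set A) := by
  let S : StarSubalgebra ℂ A :=
    { carrier := V
      mul_mem' := fun hx hy => hmul _ hx _ hy
      add_mem' := add_mem
      algebraMap_mem' := fun c => by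
        rw [Algebra.algebraMap_eq_smul_one]
        exact V.smul_mem c h1
      star_mem' := fun hx => hstar _ hx }
  exact ⟨S.topologicalClosure, S.topologicalClosure_coe⟩

/-! ### The twisted trace identity on spanning elements -/

open Toeplitz

/-- The values of a functional on the spanning elements `W_p W_q^*` that characterise the KMS
states: they only depend on the values on the powers of the unitary `u`. -/
structure HasSpanningValues (β : ℝ) (φ : Toeplitz →ₗ[ℂ] ℂ) : Prop where
  eq_zero : ∀ p q : PN, (p.a = q.a → ¬ ((p.a : ℕ) : ℤ) ∣ (p.m : ℤ) - q.m) →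
    φ (W p * star (W q)) = 0
  eq_rpow_mul : ∀ (p q : PN) (z : ℤ), p.a = q.a → (p.m : ℤ) - q.m = ((p.a : ℕ) : ℤ) * z →
    φ (W p * star (W q)) =
      (((p.a : ℕ) : ℝ) ^ (-β) : ℝ) * φ ((u ^ z : unitary Toeplitz) : Toeplitz)

namespace HasSpanningValues

variable {β : ℝ} {φ : Toeplitz →ₗ[ℂ] ℂ}

/-- The twisted trace property on a spanning element `W_p W_q^*` and a generator `W_r`. -/
lemma apply_mul_W (h : HasSpanningValues β φ) (p q r : PN) :
    φ (W p * star (W q) * W r) =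
      (((r.a : ℕ) : ℝ) ^ β : ℝ) * φ (W r * (W p * star (W q))) := by
  have e : W r * (W p * star (W q)) = W (r * p) * star (W q) := by rw [map_mul, mul_assoc]
  have hap : ((p.a : ℕ) : ℤ) ≠ 0 := by exact_mod_cast p.a.ne_zero
  have har : ((r.a : ℕ) : ℤ) ≠ 0 := by exact_mod_cast r.a.ne_zero
  rw [mul_assoc, e]
  by_cases hqr : (q.coset ∩ r.coset).Nonempty
  · obtain ⟨q', r', hl, hlcm, hW⟩ := isCovariant_W.exists_star_mul_eq hqr
    have hl_a : q.a * q'.a = r.a * r'.a := congrArg PN.a hl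
    have hl_m : (q.m : ℤ) + q.a * q'.m = r.m + r.a * r'.m := by
      exact_mod_cast congrArg PN.m hl
    rw [hW, ← mul_assoc, ← map_mul]
    -- Both sides vanish unless `r.a * p.a = q.a`. In that case `r.a` divides `q.a`, so the lcm is
    -- `q.a`, whence `q'.a = 1` and `r'.a = p.a`.
    by_cases ha : r.a * p.a = q.a
    · have hq' : q'.a = 1 := by
        have h1 : q.a * q'.a = q.a := by
          rw [← PN.mul_a, hlcm]
          refine PNat.dvd_antisymm ?_ (PNat.dvd_lcm_left _ _)
          exact PNat.lcm_dvd dvd_rfl ⟨p.a, ha.symm⟩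
        exact mul_eq_left.mp h1
      have hr' : p.a = r'.a := by
        rw [hq', mul_one, ← ha] at hl_a
        exact mul_left_cancel hl_a
      have hqa : ((q.a : ℕ) : ℤ) = r.a * p.a := by rw [← ha]; push_cast; rfl
      by_cases hd : ((p.a : ℕ) : ℤ) ∣ (p.m : ℤ) + p.a * q'.m - r'.m
      · obtain ⟨z, hz⟩ := hd
        -- The offset difference on the right is `r.a` times the one on the left, as is the modulus,
        -- so the same power `u ^ z` occurs; the scalars agree since `p.a ^ (-β) = r.a ^ β * (r.a *
        -- p.a) ^ (-β)`.
        rw [h.eq_rpow_mul (p * q') r' z (by rw [PN.mul_a, hq', mul_one, hr'])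
            (by rw [PN.mul_a, hq', mul_one, ← hz]; push_cast [PN.mul_m]; ring),
          h.eq_rpow_mul (r * p) q z ha (by
            push_cast [PN.mul_m, PN.mul_a]
            rw [hqa] at hl_m
            linear_combination (r.a : ℤ) * hz - hl_m),
          ← mul_assoc, ← Complex.ofReal_mul]
        congr 2
        rw [PN.mul_a, hq', mul_one, PN.mul_a, PNat.mul_coe, Nat.cast_mul,
          Real.mul_rpow (by positivity) (by positivity), ← mul_assoc,
          ← Real.rpow_add (by exact_mod_cast r.a.pos), add_neg_cancel, Real.rpow_zero, one_mul]
      · rw [h.eq_zero (p * q') r', h.eq_zero (r * p) q, mul_zero]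
        · rintro - ⟨z, hz⟩
          refine hd ⟨z, mul_left_cancel₀ har ?_⟩
          push_cast [PN.mul_m, PN.mul_a] at hz
          rw [hqa] at hl_m
          linear_combination hz + hl_m
        · intro _ hd'
          rw [PN.mul_a, hq', mul_one] at hd'
          push_cast [PN.mul_m] at hd'
          exact hd hd'
    · rw [h.eq_zero (p * q') r', h.eq_zero (r * p) q (fun h' => absurd h' ha), mul_zero]
      intro h'
      refine absurd ?_ ha
      rw [← h', PN.mul_a, ← mul_assoc] at hl_a
      exact (mul_right_cancel hl_a).symm
  · rw [Set.not_nonempty_iff_eq_empty] at hqr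
    rw [isCovariant_W.star_mul_eq_zero hqr, mul_zero, map_zero, h.eq_zero, mul_zero]
    -- A nonzero value on the right would need a congruence that makes the cosets of `q` and `r`
    -- meet.
    rintro ha ⟨z, hz⟩
    refine Set.nonempty_iff_ne_empty.mp (PN.coset_inter_nonempty (x := z) (y := p.m) ?_) hqr
    rw [← ha]
    push_cast [PN.mul_m] at hz ⊢
    linear_combination -hz

/-- The functional is invariant under the dynamics on spanning elements. -/
lemma apply_sigma_W_mul_star (h : HasSpanningValues β φ) (r : ℝ) (p q : PN) :
    φ (sigma r (W p * star (W q))) = φ (W p * star (W q)) := by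
  rw [map_mul, map_star, sigma_W, sigma_W, star_smul, smul_mul_smul_comm, map_smul]
  by_cases ha : p.a = q.a
  · rw [ha, mul_comm, phase_star_mul, one_smul]
  · rw [h.eq_zero p q (fun h' => absurd h' ha), smul_zero]

end HasSpanningValues

/-! ### Density of the span and extension by continuity -/

namespace Toeplitz

/-- The linear span of the elements `W_p W_q^*`. -/
def spanWW : Submodule ℂ Toeplitz :=
  Submodule.span ℂ (Set.range fun x : PN × PN => W x.1 * star (W x.2))

lemma W_mul_star_mem (p q : PN) : W p * star (W q) ∈ spanWW :=
  Submodule.subset_span ⟨(p, q), rfl⟩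

lemma W_mem_spanWW (p : PN) : W p ∈ spanWW := by
  simpa using W_mul_star_mem p 1

lemma mul_mem_spanWW {x y : Toeplitz} (hx : x ∈ spanWW) (hy : y ∈ spanWW) : x * y ∈ spanWW := by
  have hxy := Submodule.mul_mem_mul hx hy
  rw [spanWW, Submodule.span_mul_span] at hxy
  refine Submodule.span_le.mpr ?_ hxy
  rintro _ ⟨_, ⟨⟨p, q⟩, rfl⟩, _, ⟨⟨p', q'⟩, rfl⟩, rfl⟩
  change W p * star (W q) * (W p' * star (W q')) ∈ spanWW
  rw [mul_assoc, ← mul_assoc (star (W q))]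
  rcases (q.coset ∩ p'.coset).eq_empty_or_nonempty with he | hne
  · rw [isCovariant_W.star_mul_eq_zero he, zero_mul, mul_zero]
    exact zero_mem _
  · obtain ⟨a, b, -, -, hW⟩ := isCovariant_W.exists_star_mul_eq hne
    rw [hW, mul_assoc, ← star_mul, ← mul_assoc, ← map_mul, ← map_mul]
    exact W_mul_star_mem _ _

lemma star_mem_spanWW {x : Toeplitz} (hx : x ∈ spanWW) : star x ∈ spanWW := by
  induction hx using Submodule.span_induction with
  | mem x hx =>
    obtain ⟨⟨p, q⟩, rfl⟩ := hx
    rw [star_mul, star_star]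
    exact W_mul_star_mem q p
  | zero => rw [star_zero]; exact zero_mem _
  | add x y _ _ hx hy => rw [star_add]; exact add_mem hx hy
  | smul c x _ hx => rw [star_smul]; exact Submodule.smul_mem _ _ hx

/-- The elements `W_p W_q^*` span a dense subspace. -/
lemma dense_spanWW : Dense (spanWW : Set Toeplitz) := by
  obtain ⟨S, hS⟩ := spanWW.exists_starSubalgebra_coe_eq_closure
    (by rw [← map_one W]; exact W_mem_spanWW 1) (fun _ hx _ hy => mul_mem_spanWW hx hy)
    (fun _ => star_mem_spanWW)
  intro x
  rw [← hS]
  refine mem_of_W_mem S (hS ▸ isClosed_closure) (fun p => ?_) x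
  rw [← SetLike.mem_coe, hS]
  exact subset_closure (W_mem_spanWW p)

/-- Two continuous linear functionals that agree on all `W_p W_q^*` are equal. -/
lemma linearMap_ext {f g : Toeplitz →ₗ[ℂ] ℂ} (hf : Continuous f) (hg : Continuous g)
    (h : ∀ p q, f (W p * star (W q)) = g (W p * star (W q))) : f = g := by
  refine DFunLike.coe_injective (hf.ext_on dense_spanWW hg ?_)
  refine LinearMap.eqOn_span ?_
  rintro _ ⟨⟨p, q⟩, rfl⟩
  exact h p q

lemma continuous_sigma_apply (r : ℝ) : Continuous (sigma r) :=
  AddMonoidHomClass.continuous_of_bound (sigmaHom r) 1 fun x => by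
    rw [one_mul]
    exact NonUnitalStarAlgHom.norm_apply_le _ x

end Toeplitz

namespace HasSpanningValues

variable {β : ℝ} {φ : Toeplitz →ₗ[ℂ] ℂ}

lemma apply_sigma (h : HasSpanningValues β φ) (hφ : Continuous φ) (r : ℝ) (x : Toeplitz) :
    φ (sigma r x) = φ x :=
  DFunLike.congr_fun (linearMap_ext (f := φ ∘ₗ (sigmaHom r).toLinearMap) (g := φ)
    (hφ.comp (continuous_sigma_apply r)) hφ (h.apply_sigma_W_mul_star r)) x

lemma apply_mul_W' (h : HasSpanningValues β φ) (hφ : Continuous φ) (r : PN) (x : Toeplitz) :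
    φ (x * W r) = (((r.a : ℕ) : ℝ) ^ β : ℝ) * φ (W r * x) :=
  DFunLike.congr_fun (linearMap_ext (f := φ ∘ₗ LinearMap.mulRight ℂ (W r))
    (g := LinearMap.mulLeft ℂ ((((r.a : ℕ) : ℝ) ^ β : ℝ) : ℂ) ∘ₗ φ ∘ₗ LinearMap.mulLeft ℂ (W r))
    (hφ.comp (continuous_mul_const (W r)))
    ((continuous_const_mul _).comp (hφ.comp (continuous_const_mul (W r))))
    (fun p q => h.apply_mul_W p q r)) x

end HasSpanningValues

/-! ### Eigenvectors of the dynamics and the KMS condition -/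

/-- `y` is an eigenvector of the dynamics, with `σ_r(y) = e^{irL} y`, and `φ` satisfies the
corresponding twisted trace identity against all elements. -/
def IsTwistedTracial (β : ℝ) (φ : Toeplitz →ₗ[ℂ] ℂ) (y : Toeplitz) (L : ℝ) : Prop :=
  (∀ r : ℝ, sigma r y = Complex.exp (Complex.I * r * L) • y) ∧
    ∀ x, φ (x * y) = Complex.exp (β * L) * φ (y * x)

namespace IsTwistedTracial

variable {β : ℝ} {φ : Toeplitz →ₗ[ℂ] ℂ}

lemma W (h : HasSpanningValues β φ) (hφ : Continuous φ) (p : PN) :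
    IsTwistedTracial β φ (W p) (Real.log (p.a : ℕ)) := by
  have hp : ((p.a : ℕ) : ℂ) ≠ 0 := Nat.cast_ne_zero.2 p.a.ne_zero
  refine ⟨fun r => ?_, fun x => ?_⟩
  · rw [sigma_W, Complex.cpow_def_of_ne_zero hp, Complex.natCast_log]
    ring_nf
  · rw [h.apply_mul_W' hφ, Real.rpow_def_of_pos (by exact_mod_cast p.a.pos)]
    push_cast
    ring_nf

lemma mul {y y' : Toeplitz} {L L' : ℝ} (h : IsTwistedTracial β φ y L)
    (h' : IsTwistedTracial β φ y' L') : IsTwistedTracial β φ (y * y') (L + L') := by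
  refine ⟨fun r => ?_, fun x => ?_⟩
  · rw [map_mul, h.1, h'.1, smul_mul_smul_comm, ← Complex.exp_add]
    push_cast
    ring_nf
  · rw [← mul_assoc, h'.2, ← mul_assoc, h.2, ← mul_assoc, ← Complex.exp_add, mul_assoc y]
    push_cast
    ring_nf

/-- Conjugating the trace identity at `star x` exchanges its two sides, which inverts the factor
`exp (β * L)`. -/
lemma star (hφ : IsState φ) {y : Toeplitz} {L : ℝ} (h : IsTwistedTracial β φ y L) :
    IsTwistedTracial β φ (star y) (-L) := by
  refine ⟨fun r => ?_, fun x => ?_⟩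
  · rw [map_star, h.1, star_smul, Complex.star_def, ← Complex.exp_conj]
    simp
  · have e := congrArg (starRingEnd ℂ) (h.2 (Star.star x))
    rw [map_mul (starRingEnd ℂ), ← Complex.exp_conj, map_mul (starRingEnd ℂ), Complex.conj_ofReal,
      Complex.conj_ofReal, ← Complex.star_def, ← hφ.map_star, ← hφ.map_star, star_mul, star_mul,
      star_star] at e
    rw [e, ← mul_assoc, ← Complex.exp_add]
    simp

/-- The KMS condition against an eigenvector, by the identity theorem. -/
lemma apply_mul (hφ : Continuous φ) (hinv : ∀ r x, φ (sigma r x) = φ x)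
    {y : Toeplitz} {L : ℝ} (h : IsTwistedTracial β φ y L) {x : Toeplitz} {F : ℂ → Toeplitz}
    (hF : IsEntireExtension sigma x F) : φ (x * y) = φ (y * F (Complex.I * β)) := by
  let Φ : Toeplitz →L[ℂ] ℂ := ⟨φ ∘ₗ LinearMap.mulLeft ℂ y, hφ.comp (continuous_const_mul y)⟩
  have hreal (r : ℝ) : φ (y * F r) = Complex.exp (-(Complex.I * r * L)) * φ (y * x) := by
    rw [hF.2 r, ← hinv r (y * x), map_mul (sigma r), h.1, smul_mul_assoc, map_smul, smul_eq_mul,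
      ← mul_assoc, ← Complex.exp_add, neg_add_cancel, Complex.exp_zero, one_mul]
  have hG : Differentiable ℂ fun z => φ (y * F z) := Φ.differentiable.comp hF.1
  have hE : Differentiable ℂ fun z : ℂ => Complex.exp (-(Complex.I * z * L)) * φ (y * x) := by
    fun_prop
  have heq := AnalyticOnNhd.eq_of_frequently_eq (𝕜 := ℂ) (z₀ := 0)
    -- The two entire functions agree on the real axis, which accumulates at `0`.
    (fun z _ => hG.analyticAt z) (fun z _ => hE.analyticAt z) (by
      have ht : Filter.Tendsto (fun r : ℝ => (r : ℂ)) (nhdsWithin 0 {0}ᶜ)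
          (nhdsWithin 0 {0}ᶜ) :=
        Complex.continuous_ofReal.continuousWithinAt.tendsto_nhdsWithin
          (fun r hr => by simpa using hr)
      exact ht.frequently (Filter.Frequently.of_forall hreal))
  have := congrFun heq (Complex.I * β)
  rw [this, h.2]
  congr 2
  linear_combination (β * L : ℂ) * Complex.I_mul_I

end IsTwistedTracial

/-- With `x` and its extension `F` fixed, both sides are continuous and linear in `y`, so only `y =
W p * star (W q)` has to be tested and `x` is never approximated. -/
lemma HasSpanningValues.isKMSState {β : ℝ} {φ : Toeplitz →ₗ[ℂ] ℂ} (h : HasSpanningValues β φ)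
    (hφ : IsState φ) : IsKMSState sigma β φ := by
  have hc := LinearMap.continuous_of_isState hφ
  refine ⟨hφ, fun x y F hF _ => ?_⟩
  refine DFunLike.congr_fun (linearMap_ext (f := φ ∘ₗ LinearMap.mulLeft ℂ x)
    (g := φ ∘ₗ LinearMap.mulRight ℂ (F (Complex.I * β)))
    (hc.comp (continuous_const_mul x)) (hc.comp (continuous_mul_const _)) fun p q => ?_) y
  exact ((IsTwistedTracial.W h hc p).mul ((IsTwistedTracial.W h hc q).star hφ)).apply_mul hc
    (h.apply_sigma hc) hF

end

theorem theorem4p4 (β : ℝ) (hβ : 1 ≤ β) (φ : Toeplitz →ₗ[ℂ] ℂ) (hφ : IsState φ)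
    (hzero : ∀ (a b : ℕ+) (x₁ y₁ x₂ y₂ : ℕ),
      (a ≠ b ∨ ¬ (2 * (x₁ : ℤ) + 3 * y₁ ≡ 2 * (x₂ : ℤ) + 3 * y₂ [ZMOD ((a : ℕ) : ℤ)])) →
      φ (Toeplitz.s ^ x₁ * Toeplitz.t ^ y₁ * Toeplitz.v a * star (Toeplitz.v b) *
        star Toeplitz.t ^ y₂ * star Toeplitz.s ^ x₂) = 0)
    (hvalue : ∀ (a b : ℕ+) (x₁ y₁ x₂ y₂ : ℕ),
      a = b → 2 * (x₁ : ℤ) + 3 * y₁ ≡ 2 * (x₂ : ℤ) + 3 * y₂ [ZMOD ((a : ℕ) : ℤ)] →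
      ∃ u k l : ℤ, (y₁ : ℤ) - y₂ + 2 * u = a * l ∧ (x₁ : ℤ) - x₂ - 3 * u = a * k ∧
        φ (Toeplitz.s ^ x₁ * Toeplitz.t ^ y₁ * Toeplitz.v a * star (Toeplitz.v b) *
          star Toeplitz.t ^ y₂ * star Toeplitz.s ^ x₂) =
        (((a : ℕ) : ℝ) ^ (-β) : ℝ) * φ (signedPow Toeplitz.t l * signedPow Toeplitz.s k)) :
    IsKMSState Toeplitz.sigma β φ := by
  refine HasSpanningValues.isKMSState ⟨fun p q h => ?_, fun p q z ha hz => ?_⟩ hφ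
  · obtain ⟨x₁, y₁, x₂, y₂, hp, hq, e⟩ := Toeplitz.exists_W_mul_star_eq p q
    rw [e]
    refine hzero _ _ _ _ _ _ (or_iff_not_imp_left.mpr fun ha hmod => ?_)
    refine h (not_not.mp ha) ?_
    rw [hp, hq]
    exact_mod_cast hmod.symm.dvd
  · obtain ⟨x₁, y₁, x₂, y₂, hp, hq, e⟩ := Toeplitz.exists_W_mul_star_eq p q
    rw [hp, hq] at hz
    push_cast at hz
    obtain ⟨w, k, l, hl, hk, hval⟩ := hvalue p.a q.a x₁ y₁ x₂ y₂ ha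
      (Int.modEq_iff_dvd.mpr ⟨z, hz⟩).symm
    -- In `3 * (y₁ - y₂ + 2 * w) + 2 * (x₁ - x₂ - 3 * w)` the `w` cancels, leaving the offset
    -- difference `p.a * z`.
    have hz' : 3 * l + 2 * k = z := by
      refine mul_left_cancel₀ (Nat.cast_ne_zero.2 p.a.ne_zero : ((p.a : ℕ) : ℤ) ≠ 0) ?_
      linear_combination hz - 3 * hl - 2 * hk
    rw [e, hval, Toeplitz.signedPow_mul_signedPow, hz']
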